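/- For a function $f:[0,\infty)\to\mathbb{C}$ with $\int_0^\infty |f(t)|^2e^{-t}\,dt<\infty$ put $$\|f\| := \left(\int_0^\infty |f(t)|^2 e^{-t}\,dt\right)^{1/2}.$$ Let $n\ge 1$ be an integer and let $a_1,\dots,a_n,\lambda_1,\dots,\lambda_n\in\mathbb{C}$ with $\operatorname{Re}(\lambda_j)<1/2$ for every $j$. Then for the exponential sum $f(t)=\sum_{j=1}^n a_je^{\lambda_jt}$ the norms $\|f\|$ and $\|f'\|$ are finite and $$\|f'\| \le \left(\max_{1\le j\le n}|\lambda_j| + \left(\sum_{j=1}^n \bigl(1-2\operatorname{Re}(\lambda_j)\bigr)\sum_{k=j+1}^n\bigl(1-2\operatorname{Re}(\lambda_k)\bigr)\right)^{1/2}\right)\|f\|.$$ -/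

import Mathlib

open MeasureTheory

noncomputable section

/-- The exponential sum `t ↦ ∑ⱼ aⱼ e^{λⱼ t}` with complex coefficients and exponents. -/
def expSum {n : ℕ} (a lam : Fin n → ℂ) (t : ℝ) : ℂ :=
  ∑ j, a j * Complex.exp (lam j * (t : ℂ))

/-- `|f|²` is integrable on `(0, ∞)` against the Laguerre weight `e^{-t}`. -/
def LaguerreSqIntegrable (f : ℝ → ℂ) : Prop :=
  IntegrableOn (fun t : ℝ => ‖f t‖ ^ 2 * Real.exp (-t)) (Set.Ioi 0)

/-- The Laguerre-weighted norm `(∫₀^∞ |f(t)|² e^{-t} dt)^{1/2}`. This is the intended value when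
`LaguerreSqIntegrable f` holds. -/
def laguerreNorm (f : ℝ → ℂ) : ℝ :=
  Real.sqrt (∫ t in Set.Ioi (0 : ℝ), ‖f t‖ ^ 2 * Real.exp (-t))

end

open MeasureTheory Filter Topology ComplexConjugate

section Laguerre

variable {n : ℕ}

/-! Differentiation on exponential sums is modelled by an upper triangular matrix `T` satisfying `T
+ T* = 1 - ℓ* ℓ`, where `ℓ` plays the role of evaluation at `0`. If `y' = T y`, this identity makes
`‖ℓ y‖² e^{-t}` the derivative of `-‖y‖² e^{-t}`, so the Laguerre norm of `ℓ y` is `‖y 0‖`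
(`laguerre_isometry`). No orthogonalization is carried out, and repeated exponents need no separate
case. It remains to bound the operator norm of `T` (`norm_derivMatrix_mulVec_le`). -/

theorem hasDerivAt_const_mul_cexp (a z : ℂ) (t : ℝ) :
    HasDerivAt (fun s : ℝ => a * Complex.exp (z * (s : ℂ)))
      (z * a * Complex.exp (z * (t : ℂ))) t := by
  have h : HasDerivAt (fun s : ℝ => z * (s : ℂ)) z t := by
    simpa using (Complex.ofRealCLM.hasDerivAt (x := t)).const_mul z
  exact (h.cexp.const_mul a).congr_deriv (by ring)

theorem hasDerivAt_expSum (a lam : Fin n → ℂ) (t : ℝ) :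
    HasDerivAt (expSum a lam) (expSum (fun k => lam k * a k) lam t) t := by
  unfold expSum
  exact HasDerivAt.fun_sum fun k _ => hasDerivAt_const_mul_cexp (a k) (lam k) t

theorem deriv_expSum (a lam : Fin n → ℂ) :
    deriv (expSum a lam) = expSum (fun k => lam k * a k) lam :=
  funext fun t => (hasDerivAt_expSum a lam t).deriv

/-- If `T` satisfies the Lyapunov identity `T + T* = 1 - ℓ* ℓ` and `c k` are eigenvectors of `T`
normalized by `ℓ (c k) = 1`, then `∑ aₖ cₖ ↦ expSum a lam` is isometric for the Laguerre norm. -/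
theorem laguerre_isometry {E : Type*} [NormedAddCommGroup E] [InnerProductSpace ℂ E]
    (T : E →ₗ[ℂ] E) (l : E →ₗ[ℂ] ℂ)
    (hT : ∀ v, 2 * (inner ℂ v (T v)).re = ‖v‖ ^ 2 - ‖l v‖ ^ 2)
    (lam : Fin n → ℂ) (hlam : ∀ j, (lam j).re < 1 / 2)
    (c : Fin n → E) (hc : ∀ k, T (c k) = lam k • c k) (hlc : ∀ k, l (c k) = 1)
    (a : Fin n → ℂ) :
    LaguerreSqIntegrable (expSum a lam) ∧ laguerreNorm (expSum a lam) = ‖∑ k, a k • c k‖ := by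
  set y : ℝ → E := fun t => ∑ k, (a k * Complex.exp (lam k * (t : ℂ))) • c k with hy
  have hTy : ∀ t, T (y t) = ∑ k, (lam k * a k * Complex.exp (lam k * (t : ℂ))) • c k := fun t => by
    simp only [hy, map_sum, map_smul, hc, smul_smul]
    exact Finset.sum_congr rfl fun k _ => by ring_nf
  have hly : ∀ t, l (y t) = expSum a lam t := fun t => by
    simp [hy, map_sum, hlc, expSum]
  have hderiv : ∀ t, HasDerivAt y (T (y t)) t := fun t => by
    rw [hTy]
    exact HasDerivAt.fun_sum fun k _ =>
      (hasDerivAt_const_mul_cexp (a k) (lam k) t).smul_const (c k)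
  have henergy : ∀ t : ℝ, HasDerivAt (fun t => -(‖y t‖ ^ 2 * Real.exp (-t)))
      (‖expSum a lam t‖ ^ 2 * Real.exp (-t)) t := fun t => by
    have h1 : HasDerivAt (fun t => ‖y t‖ ^ 2) (2 * (inner ℂ (y t) (T (y t))).re) t := by
      have h2 := (hderiv t).inner ℂ (hderiv t)
      have h3 := Complex.reCLM.hasFDerivAt.comp_hasDerivAt t h2
      have h4 := inner_re_symm (𝕜 := ℂ) (T (y t)) (y t)
      simp only [RCLike.re_to_complex] at h4
      refine (h3.congr_deriv (by simp [h4, two_mul])).congr_of_eventuallyEq ?_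
      exact Eventually.of_forall fun s => (inner_self_eq_norm_sq (𝕜 := ℂ) (y s)).symm
    have h4 : HasDerivAt (fun t : ℝ => Real.exp (-t)) (-Real.exp (-t)) t := by
      simpa using (hasDerivAt_neg t).exp
    refine (h1.mul h4).neg.congr_deriv ?_
    rw [hT, hly]
    ring
  -- Since `Re λₖ < 1/2`, each term of `y t * e^{-t/2}` decays exponentially.
  have hlim : Tendsto (fun t : ℝ => -(‖y t‖ ^ 2 * Real.exp (-t))) atTop (𝓝 0) := by
    have hz : Tendsto (fun t : ℝ => ∑ k, ‖a k‖ * ‖c k‖ * Real.exp (((lam k).re - 1 / 2) * t))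
        atTop (𝓝 0) := by
      rw [show (0 : ℝ) = ∑ _k : Fin n, (0 : ℝ) from Finset.sum_const_zero.symm]
      refine tendsto_finsetSum _ fun k _ => ?_
      rw [← mul_zero (‖a k‖ * ‖c k‖)]
      refine Tendsto.const_mul _ (Real.tendsto_exp_atBot.comp ?_)
      exact tendsto_id.const_mul_atTop_of_neg (by linarith [hlam k])
    have hle : ∀ t : ℝ, ‖y t‖ * Real.exp (-t / 2) ≤
        ∑ k, ‖a k‖ * ‖c k‖ * Real.exp (((lam k).re - 1 / 2) * t) := fun t => by
      calc ‖y t‖ * Real.exp (-t / 2)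
          ≤ (∑ k, ‖(a k * Complex.exp (lam k * (t : ℂ))) • c k‖) * Real.exp (-t / 2) := by
            gcongr; exact norm_sum_le _ _
        _ = _ := by
            rw [Finset.sum_mul]
            refine Finset.sum_congr rfl fun k _ => ?_
            rw [norm_smul, norm_mul, Complex.norm_exp,
              show ((lam k).re - 1 / 2) * t = (lam k * (t : ℂ)).re + -t / 2 by simp; ring,
              Real.exp_add]
            ring
    have h0 : Tendsto (fun t : ℝ => ‖y t‖ * Real.exp (-t / 2)) atTop (𝓝 0) :=
      squeeze_zero (fun t => by positivity) hle hz
    have h1 := (h0.pow 2).neg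
    simp only [ne_eq, OfNat.ofNat_ne_zero, not_false_eq_true, zero_pow, neg_zero] at h1
    refine h1.congr fun t => ?_
    rw [mul_pow, ← Real.exp_nat_mul]
    congr 3
    push_cast
    ring
  have hint : IntegrableOn (fun t : ℝ => ‖expSum a lam t‖ ^ 2 * Real.exp (-t)) (Set.Ioi 0) :=
    integrableOn_Ioi_deriv_of_nonneg' (fun t _ => henergy t) (fun t _ => by positivity) hlim
  refine ⟨hint, ?_⟩
  rw [laguerreNorm, integral_Ioi_of_hasDerivAt_of_tendsto' (fun t _ => henergy t) hint hlim]
  simp [hy]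

theorem sum_conj_mul_sum_eq (w : Fin n → ℂ) :
    ‖∑ i, w i‖ ^ 2 = ∑ i, ‖w i‖ ^ 2 + 2 * (∑ i, conj (w i) * ∑ j ∈ Finset.Ioi i, w j).re := by
  induction n with
  | zero => simp
  | succ n ih =>
    have hIoi : ∀ i : Fin n, ∑ j ∈ Finset.Ioi i.succ, w j = ∑ j ∈ Finset.Ioi i, w (Fin.succ j) :=
      fun i => by simp [← Fin.map_succEmb_Ioi]
    have h0 : ∑ j ∈ Finset.Ioi (0 : Fin (n + 1)), w j = ∑ j, w (Fin.succ j) := by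
      simp [Fin.Ioi_zero_eq_map]
    rw [Fin.sum_univ_succ, Fin.sum_univ_succ, Fin.sum_univ_succ, h0]
    simp only [hIoi]
    rw [Complex.add_re, mul_add, ← add_assoc, add_right_comm, add_assoc, ← add_assoc _ _ (2 * _)]
    have := ih fun i => w i.succ
    rw [← Complex.normSq_eq_norm_sq, Complex.normSq_add, Complex.normSq_eq_norm_sq,
      Complex.normSq_eq_norm_sq, this]
    simp only [Complex.mul_re, Complex.conj_re, Complex.conj_im]
    ring

/-- The matrix of `d/dt` in the orthonormal basis obtained from the exponentials `e^{λⱼ t}` by the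
Gram-Schmidt process in the Laguerre inner product. -/
noncomputable def derivMatrix (lam : Fin n → ℂ) : Matrix (Fin n) (Fin n) ℂ := fun i j =>
  if i = j then lam i
  else if i < j then -((√(1 - 2 * (lam i).re) : ℂ) * (√(1 - 2 * (lam j).re) : ℂ)) else 0

theorem derivMatrix_mulVec (lam v : Fin n → ℂ) (i : Fin n) :
    (derivMatrix lam).mulVec v i = lam i * v i -
      (√(1 - 2 * (lam i).re) : ℂ) * ∑ j ∈ Finset.Ioi i, (√(1 - 2 * (lam j).re) : ℂ) * v j := by
  have h : ∀ j, derivMatrix lam i j * v j = (if i = j then lam i * v i else 0) +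
      if i < j then -((√(1 - 2 * (lam i).re) : ℂ) * ((√(1 - 2 * (lam j).re) : ℂ) * v j))
        else 0 := fun j => by
    unfold derivMatrix
    rcases lt_trichotomy i j with h | rfl | h
    · simp [h, h.ne]; ring
    · simp
    · simp [h.not_gt, h.ne']
  rw [Matrix.mulVec, dotProduct, Finset.sum_congr rfl fun j _ => h j, Finset.sum_add_distrib,
    ← Finset.sum_filter (fun j => i < j), Finset.filter_lt_eq_Ioi, Finset.sum_neg_distrib, Finset.mul_sum]
  simp [sub_eq_add_neg]

theorem exists_derivMatrix_eigenvector (lam : Fin n → ℂ) (k : Fin n) :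
    ∃ v ≠ 0, (derivMatrix lam).mulVec v = lam k • v := by
  have hdet : (derivMatrix lam - lam k • (1 : Matrix (Fin n) (Fin n) ℂ)).det = 0 := by
    rw [Matrix.det_of_isUpperTriangular]
    · exact Finset.prod_eq_zero (Finset.mem_univ k) (by simp [derivMatrix])
    · intro i j hij
      have hij : j < i := hij
      simp [derivMatrix, hij.ne', hij.not_gt]
  obtain ⟨v, hv, h⟩ := Matrix.exists_mulVec_eq_zero_iff.2 hdet
  refine ⟨v, hv, ?_⟩
  rwa [Matrix.sub_mulVec, Matrix.smul_mulVec, Matrix.one_mulVec, sub_eq_zero] at h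

/-- Put `wᵢ = √(1 - 2 Re λᵢ) vᵢ`. The diagonal contributes `∑ (‖vᵢ‖² - ‖wᵢ‖²)`; the strictly upper
part contributes minus the cross terms of `‖∑ wᵢ‖²`. -/
theorem derivMatrix_lyapunov (lam : Fin n → ℂ) (hlam : ∀ j, (lam j).re < 1 / 2)
    (v : Fin n → ℂ) :
    2 * (∑ i, conj (v i) * (derivMatrix lam).mulVec v i).re =
      ∑ i, ‖v i‖ ^ 2 - ‖∑ i, (√(1 - 2 * (lam i).re) : ℂ) * v i‖ ^ 2 := by
  rw [sum_conj_mul_sum_eq, ← sub_sub, ← Finset.sum_sub_distrib, Complex.re_sum, Complex.re_sum,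
    Finset.mul_sum, Finset.mul_sum, ← Finset.sum_sub_distrib]
  refine Finset.sum_congr rfl fun i _ => ?_
  have hr : √(1 - 2 * (lam i).re) ^ 2 = 1 - 2 * (lam i).re :=
    Real.sq_sqrt (by linarith [hlam i])
  rw [derivMatrix_mulVec, norm_mul, mul_pow, Complex.norm_real, Real.norm_eq_abs, sq_abs, hr,
    ← Complex.normSq_eq_norm_sq, Complex.normSq_apply]
  simp only [map_mul, Complex.conj_ofReal, Complex.mul_re, Complex.mul_im, Complex.sub_re,
    Complex.sub_im, Complex.conj_re, Complex.conj_im, Complex.ofReal_re, Complex.ofReal_im]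
  ring

/-- The diagonal part has norm at most `max ‖λⱼ‖`; the square root is the Hilbert-Schmidt norm of
the strictly upper part. -/
theorem norm_derivMatrix_mulVec_le [NeZero n] (lam : Fin n → ℂ) (hlam : ∀ j, (lam j).re < 1 / 2)
    (v : EuclideanSpace ℂ (Fin n)) :
    ‖Matrix.toEuclideanLin (derivMatrix lam) v‖ ≤
      (Finset.univ.sup' Finset.univ_nonempty (fun j => ‖lam j‖) +
        √(∑ j, (1 - 2 * (lam j).re) * ∑ k ∈ Finset.Ioi j, (1 - 2 * (lam k).re))) * ‖v‖ := by
  set M := Finset.univ.sup' Finset.univ_nonempty (fun j => ‖lam j‖) with hM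
  have hle : ∀ j, ‖lam j‖ ≤ M := fun j => Finset.le_sup' (fun j => ‖lam j‖) (Finset.mem_univ j)
  have hM0 : 0 ≤ M := (norm_nonneg _).trans (hle 0)
  have hpos : ∀ j, 0 ≤ 1 - 2 * (lam j).re := fun j => by linarith [hlam j]
  set D : EuclideanSpace ℂ (Fin n) := WithLp.toLp 2 fun i => lam i * v i
  set S : EuclideanSpace ℂ (Fin n) := WithLp.toLp 2 fun i =>
    (√(1 - 2 * (lam i).re) : ℂ) * ∑ j ∈ Finset.Ioi i, (√(1 - 2 * (lam j).re) : ℂ) * v j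
  have hDS : Matrix.toEuclideanLin (derivMatrix lam) v = D - S := by
    ext i
    exact derivMatrix_mulVec lam v i
  have hD : ‖D‖ ≤ M * ‖v‖ := by
    refine le_of_sq_le_sq ?_ (by positivity)
    rw [mul_pow, EuclideanSpace.norm_sq_eq, EuclideanSpace.norm_sq_eq, Finset.mul_sum]
    refine Finset.sum_le_sum fun i _ => ?_
    simp only [D, norm_mul, mul_pow]
    gcongr
    exact hle i
  have hS : ‖S‖ ≤ √(∑ j, (1 - 2 * (lam j).re) * ∑ k ∈ Finset.Ioi j, (1 - 2 * (lam k).re)) *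
      ‖v‖ := by
    refine le_of_sq_le_sq ?_ (by positivity)
    rw [mul_pow, Real.sq_sqrt (Finset.sum_nonneg fun j _ => mul_nonneg (hpos j)
      (Finset.sum_nonneg fun k _ => hpos k)), EuclideanSpace.norm_sq_eq, Finset.sum_mul]
    refine Finset.sum_le_sum fun i _ => ?_
    simp only [S, norm_mul, mul_pow, Complex.norm_real, Real.norm_eq_abs, sq_abs,
      Real.sq_sqrt (hpos i), mul_assoc]
    refine mul_le_mul_of_nonneg_left ?_ (hpos i)
    calc ‖∑ j ∈ Finset.Ioi i, (√(1 - 2 * (lam j).re) : ℂ) * v j‖ ^ 2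
        ≤ (∑ j ∈ Finset.Ioi i, √(1 - 2 * (lam j).re) * ‖v j‖) ^ 2 := by
          gcongr
          refine (norm_sum_le _ _).trans_eq (Finset.sum_congr rfl fun j _ => ?_)
          rw [norm_mul, Complex.norm_real, Real.norm_of_nonneg (Real.sqrt_nonneg _)]
      _ ≤ (∑ j ∈ Finset.Ioi i, √(1 - 2 * (lam j).re) ^ 2) * ∑ j ∈ Finset.Ioi i, ‖v j‖ ^ 2 :=
          Finset.sum_mul_sq_le_sq_mul_sq _ _ _
      _ ≤ (∑ j ∈ Finset.Ioi i, (1 - 2 * (lam j).re)) * ‖v‖ ^ 2 := by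
          rw [EuclideanSpace.norm_sq_eq]
          refine mul_le_mul (Finset.sum_le_sum fun j _ => (Real.sq_sqrt (hpos j)).le)
            (Finset.sum_le_univ_sum_of_nonneg fun j => by positivity)
            (Finset.sum_nonneg fun j _ => by positivity) (Finset.sum_nonneg fun j _ => hpos j)
  rw [hDS, add_mul]
  exact (norm_sub_le _ _).trans (add_le_add hD hS)

end Laguerre

theorem theorem10p1 (n : ℕ) [NeZero n] (a lam : Fin n → ℂ)
    (hlam : ∀ j, (lam j).re < 1 / 2) :
    Differentiable ℝ (expSum a lam) ∧
    LaguerreSqIntegrable (expSum a lam) ∧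
    LaguerreSqIntegrable (deriv (expSum a lam)) ∧
    laguerreNorm (deriv (expSum a lam)) ≤
      (Finset.univ.sup' Finset.univ_nonempty (fun j => ‖lam j‖) +
        Real.sqrt (∑ j, (1 - 2 * (lam j).re) * ∑ k ∈ Finset.Ioi j, (1 - 2 * (lam k).re))) *
      laguerreNorm (expSum a lam) := by
  let T := Matrix.toEuclideanLin (derivMatrix lam)
  let l : EuclideanSpace ℂ (Fin n) →ₗ[ℂ] ℂ :=
    { toFun := fun v => ∑ i, (√(1 - 2 * (lam i).re) : ℂ) * v i
      map_add' := fun v w => by simp [mul_add, Finset.sum_add_distrib]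
      map_smul' := fun z v => by simp [Finset.mul_sum, mul_left_comm] }
  have hT : ∀ v, 2 * (inner ℂ v (T v)).re = ‖v‖ ^ 2 - ‖l v‖ ^ 2 := fun v => by
    rw [EuclideanSpace.norm_sq_eq]
    refine Eq.trans ?_ (derivMatrix_lyapunov lam hlam v)
    simp only [PiLp.inner_apply, RCLike.inner_apply']
    rfl
  have hc : ∀ k, ∃ c, T c = lam k • c ∧ l c = 1 := fun k => by
    obtain ⟨v, hv, h⟩ := exists_derivMatrix_eigenvector lam k
    let u : EuclideanSpace ℂ (Fin n) := WithLp.toLp 2 v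
    have hu : u ≠ 0 := fun h0 => hv (congrArg WithLp.ofLp h0)
    have hTu : T u = lam k • u := congrArg (WithLp.toLp 2) h
    -- If `l u = 0`, then `hT` gives `2 Re λₖ ‖u‖² = ‖u‖²`, contradicting `Re λₖ < 1/2`.
    have hlu : l u ≠ 0 := fun h0 => by
      have h1 := hT u
      rw [hTu, h0, inner_smul_right, inner_self_eq_norm_sq_to_K, norm_zero] at h1
      have h2 : (lam k * ((‖u‖ : ℂ) ^ 2)).re = (lam k).re * ‖u‖ ^ 2 := by
        rw [← Complex.ofReal_pow, Complex.re_mul_ofReal]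
      have h3 : 0 < ‖u‖ ^ 2 := by positivity
      erw [h2] at h1
      nlinarith [hlam k]
    refine ⟨(l u)⁻¹ • u, ?_, ?_⟩
    · rw [map_smul, hTu, smul_comm]
    · rw [map_smul, smul_eq_mul, inv_mul_cancel₀ hlu]
  choose c hc hlc using hc
  obtain ⟨hf, hfn⟩ := laguerre_isometry T l hT lam hlam c hc hlc a
  obtain ⟨hg, hgn⟩ := laguerre_isometry T l hT lam hlam c hc hlc fun k => lam k * a k
  refine ⟨fun t => (hasDerivAt_expSum a lam t).differentiableAt, hf, ?_, ?_⟩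
  · rwa [deriv_expSum]
  · rw [deriv_expSum, hfn, hgn]
    -- On coefficients in the `c k`, `T` acts as differentiation does on the exponentials.
    have hTs : ∑ k, (lam k * a k) • c k = T (∑ k, a k • c k) := by
      simp only [map_sum, map_smul, hc, smul_smul, mul_comm]
    rw [hTs]
    exact norm_derivMatrix_mulVec_le lam hlam _
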